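/- Let $X=(\Omega,\mathcal F,P)$ be a probability space, let $E$ be a finite set with $|E|=n$, and let $X^E=(\Omega^E,\mathcal F^E,\mathbb P=P^E)$ be the product space. For an event $A\in\mathcal F^E$, an index $e\in E$ and $\psi\in\Omega^{E\setminus\{e\}}$, let $A_{e,\psi}\subseteq\Omega$ be the set of all $x\in\Omega$ such that the configuration equal to $x$ at $e$ and to $\psi$ off $e$ belongs to $A$. The influence of $e$ on $A$ is $$I_A(e)=P^{E\setminus\{e\}}\bigl(\{\psi\in\Omega^{E\setminus\{e\}}: 0<P(A_{e,\psi})<1\}\bigr).$$ There exist absolute constants $c,c'\in(0,\infty)$ (not depending on $X$, $E$ or $A$) such that, for every probability space $X$, every finite set $E$ with $|E|=n$ and every event $A\in\mathcal F^E$ with $0<\mathbb P(A)<1$, the maximum $m=\max_{e\in E}I_A(e)$ is strictly positive, $$\sum_{e\in E} I_A(e)\ \ge\ c\,\mathbb P(A)\,(1-\mathbb P(A))\,\log\frac{1}{2m},$$ and there exists $e\in E$ with $$I_A(e)\ \ge\ c'\,\mathbb P(A)\,(1-\mathbb P(A))\,\frac{\log n}{n}.$$ -/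

import Mathlib

/-- The configuration on `E` that takes the value `x` at `e` and agrees with `ψ` off `e`. -/
def extendAt {Ω E : Type*} [DecidableEq E] (e : E) (ψ : {f : E // f ≠ e} → Ω) (x : Ω) : E → Ω :=
  fun f => if h : f = e then x else ψ ⟨f, h⟩

/-- The part of `A` lying in the fibre `F_ψ = {ψ} × Ω`, as a subset of `Ω`. -/
def fibreSection {Ω E : Type*} [DecidableEq E] (A : Set (E → Ω)) (e : E)
    (ψ : {f : E // f ≠ e} → Ω) : Set Ω :=
  {x | extendAt e ψ x ∈ A}

/-- The influence of `e` on `A`: the probability, over the coordinates other than `e`, that the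
conditional probability of `A` on the fibre in direction `e` lies strictly between `0` and `1`. -/
noncomputable def influence {Ω E : Type*} [MeasurableSpace Ω] (P : MeasureTheory.Measure Ω)
    [Fintype E] [DecidableEq E] (A : Set (E → Ω)) (e : E) : ℝ :=
  (MeasureTheory.Measure.pi (fun _ : {f : E // f ≠ e} => P)).real
    {ψ | 0 < P (fibreSection A e ψ) ∧ P (fibreSection A e ψ) < 1}

/-!
On the discrete cube the tensorised logarithmic Sobolev inequality, applied to the increments of the
martingale that reveals the coordinates of the indicator of `A` one at a time, bounds
`Var * log (1 / δ)` by a multiple of the total influence when all influences are at most `δ`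
(Falik and Samorodnitsky). For a dyadic grid `E → Fin (2 ^ k)`, compress `A` until each slice along
a line is an initial segment, which does not increase the influences. Then write coordinates in
binary: flipping the digit of weight `2 ^ j` crosses the end of an initial segment with probability
at most `2 * 2 ^ j / 2 ^ k`, so the digits of a coordinate have in total at most twice its
influence. For an arbitrary probability space, draw `2 ^ k` independent samples for each coordinate;
they restrict `A` to a dyadic grid. By the second moment method, the density of the restriction is
close to the probability of `A`, and its influences exceed those of `A` by little, for suitable
samples and large `k`.
-/

open scoped BigOperators

section UniformMean

variable {X : Type*} [Fintype X]

/-- The variance of a function on a finite set with its uniform measure. -/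
noncomputable def uniformVar (f : X → ℝ) : ℝ :=
  𝔼 x, f x ^ 2 - (𝔼 x, f x) ^ 2

/-- The entropy of a function on a finite set with its uniform measure, for nonnegative functions;
`Real.log 0 = 0` makes the terms with `f x = 0` vanish, as they should. -/
noncomputable def uniformEnt (f : X → ℝ) : ℝ :=
  𝔼 x, f x * Real.log (f x) - (𝔼 x, f x) * Real.log (𝔼 x, f x)

/-- The density of a subset of a finite set, that is, its uniform measure as a real number. -/
noncomputable def uniformDensity (A : Set X) : ℝ :=
  𝔼 x, A.indicator 1 x

theorem expect_sq_nonneg (f : X → ℝ) : 0 ≤ 𝔼 x, f x ^ 2 :=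
  Finset.expect_nonneg fun _ _ => sq_nonneg _

theorem expect_abs_nonneg (f : X → ℝ) : 0 ≤ 𝔼 x, |f x| :=
  Finset.expect_nonneg fun _ _ => abs_nonneg _

theorem eq_zero_of_expect_abs_eq_zero {f : X → ℝ} (h : 𝔼 x, |f x| = 0) (x : X) : f x = 0 :=
  abs_eq_zero.1 <|
    (Finset.expect_eq_zero_iff_of_nonneg fun y _ => abs_nonneg (f y)).1 h x (Finset.mem_univ x)

theorem sq_expect_abs_le_expect_sq (f : X → ℝ) : (𝔼 x, |f x|) ^ 2 ≤ 𝔼 x, f x ^ 2 := by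
  rcases isEmpty_or_nonempty X with hX | hX
  · simp
  · simpa using Finset.expect_mul_sq_le_sq_mul_sq Finset.univ (fun x => |f x|) fun _ => (1 : ℝ)

theorem uniformVar_nonneg (f : X → ℝ) : 0 ≤ uniformVar f := by
  refine sub_nonneg.2 (le_trans ?_ (sq_expect_abs_le_expect_sq f))
  rw [← sq_abs (𝔼 x, f x)]
  gcongr
  exact Finset.abs_expect_le _ _

theorem sq_sub_sqrt_expect_sq_le (f g : X → ℝ) :
    (√(𝔼 x, f x ^ 2) - √(𝔼 x, g x ^ 2)) ^ 2 ≤ 𝔼 x, (f x - g x) ^ 2 := by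
  have cauchy_schwarz : 𝔼 x, f x * g x ≤ √(𝔼 x, f x ^ 2) * √(𝔼 x, g x ^ 2) := by
    rw [← Real.sqrt_mul (expect_sq_nonneg f)]
    exact Real.le_sqrt_of_sq_le (Finset.expect_mul_sq_le_sq_mul_sq _ _ _)
  have expand : 𝔼 x, (f x - g x) ^ 2 = 𝔼 x, f x ^ 2 + 𝔼 x, g x ^ 2 - 2 * 𝔼 x, f x * g x := by
    rw [Finset.mul_expect, ← Finset.expect_add_distrib, ← Finset.expect_sub_distrib]
    exact Finset.expect_congr rfl fun x _ => by ring
  rw [expand, sub_sq, Real.sq_sqrt (expect_sq_nonneg f), Real.sq_sqrt (expect_sq_nonneg g)]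
  linarith

theorem mul_log_le_mul_log_add {s m : ℝ} (hs : 0 ≤ s) (hm : 0 < m) :
    s * Real.log s ≤ s * Real.log m + (s ^ 2 / m - s) := by
  rcases hs.eq_or_lt with rfl | hs
  · simp
  have h := mul_le_mul_of_nonneg_left (Real.log_le_sub_one_of_pos (div_pos hs hm)) hs.le
  rw [Real.log_div hs.ne' hm.ne'] at h
  linear_combination h

theorem uniformEnt_le_uniformVar_div {f : X → ℝ} (hf : ∀ x, 0 ≤ f x) :
    uniformEnt f ≤ uniformVar f / 𝔼 x, f x := by
  have hm : 0 ≤ 𝔼 x, f x := Finset.expect_nonneg fun x _ => hf x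
  rcases hm.eq_or_lt with hm | hm
  · have hf0 : ∀ x, f x = 0 := eq_zero_of_expect_abs_eq_zero (by simp [abs_of_nonneg (hf _), ← hm])
    simp [uniformEnt, hf0]
  have tangent := Finset.expect_le_expect (s := Finset.univ)
    fun x _ => mul_log_le_mul_log_add (hf x) hm
  rw [Finset.expect_add_distrib, Finset.expect_sub_distrib, ← Finset.expect_mul,
    ← Finset.expect_div] at tangent
  have hdiv : uniformVar f / 𝔼 x, f x = (𝔼 x, f x ^ 2) / (𝔼 x, f x) - 𝔼 x, f x := by
    rw [uniformVar, sub_div, sq (𝔼 x, f x), mul_self_div_self]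
  rw [hdiv, uniformEnt]
  linarith

theorem uniformEnt_pair_sq_le (a b : ℝ) :
    uniformEnt ![a ^ 2, b ^ 2] ≤ (b - a) ^ 2 := by
  have hmean : 𝔼 i, ![a ^ 2, b ^ 2] i = (a ^ 2 + b ^ 2) / 2 := by
    simp [Fintype.expect_eq_sum_div_card]
  have hvar : uniformVar ![a ^ 2, b ^ 2] = (b - a) ^ 2 * ((a + b) ^ 2 / 4) := by
    rw [uniformVar, hmean]
    simp only [Fintype.expect_eq_sum_div_card, Fin.sum_univ_two, Matrix.cons_val_zero,
      Matrix.cons_val_one, Fintype.card_fin]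
    ring
  refine (uniformEnt_le_uniformVar_div fun i => ?_).trans ?_
  · fin_cases i <;> simp [sq_nonneg]
  · rw [hvar, hmean]
    refine div_le_of_le_mul₀ (by positivity) (by positivity) ?_
    refine mul_le_mul_of_nonneg_left ?_ (sq_nonneg _)
    linarith [two_mul_le_add_sq a b]

theorem sq_mul_log_add_sub_le {r : ℝ} (hr : 0 < r) (y : ℝ) :
    y ^ 2 * (2 * Real.log r + 2) - 2 * r * |y| ≤ y ^ 2 * Real.log (y ^ 2) := by
  rcases eq_or_ne y 0 with rfl | hy
  · simp
  have hy' : 0 < |y| := abs_pos.2 hy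
  have h := mul_le_mul_of_nonneg_left (Real.log_le_sub_one_of_pos (div_pos hr hy')) (sq_nonneg y)
  rw [Real.log_div hr.ne' hy'.ne', Real.log_abs] at h
  have hdiv : y ^ 2 * (r / |y|) = r * |y| := by
    rw [← sq_abs]
    field_simp
  rw [Real.log_pow, Nat.cast_ofNat]
  linear_combination 2 * h + 2 * hdiv

theorem expect_sq_mul_log_le_uniformEnt_sq (f : X → ℝ) :
    (𝔼 x, f x ^ 2) * Real.log ((𝔼 x, f x ^ 2) / (𝔼 x, |f x|) ^ 2) ≤
      uniformEnt fun x => f x ^ 2 := by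
  rcases (expect_abs_nonneg f).eq_or_lt with ha | ha
  · simp [uniformEnt, eq_zero_of_expect_abs_eq_zero ha.symm]
  have hv : 0 < 𝔼 x, f x ^ 2 := (pow_pos ha 2).trans_le (sq_expect_abs_le_expect_sq f)
  have tangent := Finset.expect_le_expect (s := Finset.univ)
    fun x _ => sq_mul_log_add_sub_le (div_pos hv ha) (f x)
  rw [Finset.expect_sub_distrib, ← Finset.expect_mul, ← Finset.mul_expect, mul_assoc,
    div_mul_cancel₀ _ ha.ne', Real.log_div hv.ne' ha.ne'] at tangent
  rw [uniformEnt, Real.log_div hv.ne' (pow_pos ha 2).ne', Real.log_pow, Nat.cast_ofNat]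
  linarith

theorem expect_sq_mul_le_uniformEnt_sq_add (f : X → ℝ) {K : ℝ} (hK : 0 < K) :
    (𝔼 x, f x ^ 2) * (1 - Real.log K) ≤
      (uniformEnt fun x => f x ^ 2) + (𝔼 x, |f x|) ^ 2 / K := by
  refine le_trans ?_ (add_le_add_left (expect_sq_mul_log_le_uniformEnt_sq f) _)
  rcases (expect_abs_nonneg f).eq_or_lt with ha | ha
  · simp [eq_zero_of_expect_abs_eq_zero ha.symm]
  have hv : 0 < 𝔼 x, f x ^ 2 := (pow_pos ha 2).trans_le (sq_expect_abs_le_expect_sq f)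
  set v := 𝔼 x, f x ^ 2
  set a := 𝔼 x, |f x|
  have h := mul_le_mul_of_nonneg_left
    (Real.log_le_sub_one_of_pos (show 0 < a ^ 2 / (v * K) by positivity)) hv.le
  rw [Real.log_div (by positivity) (by positivity), Real.log_mul hv.ne' hK.ne'] at h
  have hdiv : v * (a ^ 2 / (v * K)) = a ^ 2 / K := by field_simp
  rw [Real.log_div hv.ne' (by positivity)]
  linear_combination h + hdiv

theorem uniformDensity_setOf_mem {Y : Type*} (S : X → Set Y) (y : Y) :
    uniformDensity {x | y ∈ S x} = 𝔼 x, (S x).indicator 1 y :=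
  rfl

theorem uniformDensity_eq_ncard_div (A : Set X) : uniformDensity A = A.ncard / Fintype.card X := by
  classical
  rw [uniformDensity, Fintype.expect_eq_sum_div_card, Set.ncard_eq_toFinset_card']
  simp [Set.indicator_apply, Set.toFinset]

theorem uniformDensity_mono {A B : Set X} (h : A ⊆ B) : uniformDensity A ≤ uniformDensity B :=
  Finset.expect_le_expect fun x _ =>
    Set.indicator_le_indicator_of_subset h (fun _ => zero_le_one) x

theorem uniformDensity_iUnion_le {ι : Type*} [Fintype ι] (A : ι → Set X) :
    uniformDensity (⋃ i, A i) ≤ ∑ i, uniformDensity (A i) := by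
  simp only [uniformDensity_eq_ncard_div, ← Finset.sum_div]
  gcongr
  exact_mod_cast Set.ncard_iUnion_le_of_fintype A

theorem uniformDensity_le_one (A : Set X) : uniformDensity A ≤ 1 := by
  rw [uniformDensity_eq_ncard_div, ← Nat.card_eq_fintype_card]
  exact div_le_one_of_le₀ (Nat.cast_le.2 A.ncard_le_card) (Nat.cast_nonneg _)

theorem uniformVar_indicator (A : Set X) :
    uniformVar (A.indicator 1) = uniformDensity A * (1 - uniformDensity A) := by
  have h : 𝔼 x, A.indicator (1 : X → ℝ) x ^ 2 = 𝔼 x, A.indicator 1 x :=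
    Finset.expect_congr rfl fun x _ => by by_cases hx : x ∈ A <;> simp [hx]
  rw [uniformVar, h, uniformDensity]
  ring

theorem uniformDensity_preimage_equiv {Y : Type*} [Fintype Y] (σ : Y ≃ X) (A : Set X) :
    uniformDensity (σ ⁻¹' A) = uniformDensity A :=
  Fintype.expect_equiv σ _ _ fun _ => rfl

end UniformMean

section Cube

theorem cube_expect_succ {N : ℕ} (f : (Fin (N + 1) → Fin 2) → ℝ) :
    𝔼 x, f x = (𝔼 x, f (Fin.cons 0 x) + 𝔼 x, f (Fin.cons 1 x)) / 2 := by
  have h : 𝔼 x, f x = 𝔼 b : Fin 2, 𝔼 x, f (Fin.cons b x) := by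
    rw [← Finset.expect_product', Finset.univ_product_univ]
    exact (Fintype.expect_equiv (Fin.consEquiv fun _ => Fin 2) _ _ fun _ => rfl).symm
  rw [h, Fintype.expect_eq_sum_div_card, Fin.sum_univ_two, Fintype.card_fin, Nat.cast_ofNat]

theorem uniformEnt_cube_succ {N : ℕ} (f : (Fin (N + 1) → Fin 2) → ℝ) :
    uniformEnt f =
      (uniformEnt (fun x => f (Fin.cons 0 x)) + uniformEnt fun x => f (Fin.cons 1 x)) / 2 +
        uniformEnt ![𝔼 x, f (Fin.cons 0 x), 𝔼 x, f (Fin.cons 1 x)] := by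
  simp only [uniformEnt, cube_expect_succ, Fintype.expect_eq_sum_div_card (ι := Fin 2),
    Fin.sum_univ_two, Matrix.cons_val_zero, Matrix.cons_val_one, Fintype.card_fin, Nat.cast_ofNat]
  ring

/-- The discrete derivative of `f` in the direction `i`. It does not depend on the bit `x i`, and
is not divided by `2`, so that the indicator of a set has derivatives in `{-1, 0, 1}`. -/
def bitDeriv {B : Type*} [DecidableEq B] (f : (B → Fin 2) → ℝ) (i : B) (x : B → Fin 2) : ℝ :=
  f (Function.update x i 1) - f (Function.update x i 0)

/-- The Dirichlet energy of a function on the cube, normalised by `bitDeriv`. -/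
noncomputable def cubeEnergy {B : Type*} [Fintype B] [DecidableEq B] (f : (B → Fin 2) → ℝ) : ℝ :=
  ∑ i, 𝔼 x, bitDeriv f i x ^ 2

theorem bitDeriv_zero_cons {N : ℕ} (f : (Fin (N + 1) → Fin 2) → ℝ) (b : Fin 2)
    (x : Fin N → Fin 2) :
    bitDeriv f 0 (Fin.cons b x) = f (Fin.cons 1 x) - f (Fin.cons 0 x) := by
  simp [bitDeriv]

theorem bitDeriv_succ_cons {N : ℕ} (f : (Fin (N + 1) → Fin 2) → ℝ) (i : Fin N) (b : Fin 2)
    (x : Fin N → Fin 2) :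
    bitDeriv f i.succ (Fin.cons b x) = bitDeriv (fun y => f (Fin.cons b y)) i x := by
  simp [bitDeriv, Fin.cons_update]

theorem cubeEnergy_succ {N : ℕ} (f : (Fin (N + 1) → Fin 2) → ℝ) :
    cubeEnergy f = 𝔼 x : Fin N → Fin 2, (f (Fin.cons 1 x) - f (Fin.cons 0 x)) ^ 2 +
      (cubeEnergy (fun x => f (Fin.cons 0 x)) + cubeEnergy fun x => f (Fin.cons 1 x)) / 2 := by
  simp only [cubeEnergy, Fin.sum_univ_succ, cube_expect_succ, bitDeriv_zero_cons,
    bitDeriv_succ_cons, ← Finset.sum_add_distrib, ← Finset.sum_div]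
  ring

theorem uniformEnt_sq_le_cubeEnergy {N : ℕ} (f : (Fin N → Fin 2) → ℝ) :
    (uniformEnt fun x => f x ^ 2) ≤ cubeEnergy f := by
  induction N with
  | zero => simp [uniformEnt, cubeEnergy]
  | succ N ih =>
    have two_point := uniformEnt_pair_sq_le
      (√(𝔼 x : Fin N → Fin 2, f (Fin.cons 0 x) ^ 2)) (√(𝔼 x : Fin N → Fin 2, f (Fin.cons 1 x) ^ 2))
    rw [Real.sq_sqrt (expect_sq_nonneg _), Real.sq_sqrt (expect_sq_nonneg _)] at two_point
    have reverse_triangle := sq_sub_sqrt_expect_sq_le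
      (fun x : Fin N → Fin 2 => f (Fin.cons 1 x)) fun x => f (Fin.cons 0 x)
    rw [uniformEnt_cube_succ, cubeEnergy_succ]
    linarith [ih fun x => f (Fin.cons 0 x), ih fun x => f (Fin.cons 1 x)]

/-- The conditional mean of `f` given all bits but the first. -/
noncomputable def headMean {N : ℕ} (f : (Fin (N + 1) → Fin 2) → ℝ) (x : Fin N → Fin 2) : ℝ :=
  (f (Fin.cons 0 x) + f (Fin.cons 1 x)) / 2

/-- The martingale difference of `f` at the first bit: `f (Fin.cons b x)` is
`headMean f x + headDiff f x` for `b = 1` and `headMean f x - headDiff f x` for `b = 0`. -/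
noncomputable def headDiff {N : ℕ} (f : (Fin (N + 1) → Fin 2) → ℝ) (x : Fin N → Fin 2) : ℝ :=
  (f (Fin.cons 1 x) - f (Fin.cons 0 x)) / 2

theorem uniformVar_cube_succ {N : ℕ} (f : (Fin (N + 1) → Fin 2) → ℝ) :
    uniformVar f = uniformVar (headMean f) + 𝔼 x, headDiff f x ^ 2 := by
  have mean : 𝔼 x, f x = 𝔼 x, headMean f x := by
    simp only [cube_expect_succ, headMean, ← Finset.expect_div, Finset.expect_add_distrib]
  have mean_sq : 𝔼 x, f x ^ 2 = 𝔼 x, headMean f x ^ 2 + 𝔼 x, headDiff f x ^ 2 := by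
    rw [cube_expect_succ, ← Finset.expect_add_distrib, ← Finset.expect_add_distrib,
      Finset.expect_div]
    exact Finset.expect_congr rfl fun x _ => by rw [headMean, headDiff]; ring
  rw [uniformVar, uniformVar, mean, mean_sq]
  ring

theorem cubeEnergy_succ_eq_headMean_add_headDiff {N : ℕ} (f : (Fin (N + 1) → Fin 2) → ℝ) :
    cubeEnergy f =
      4 * 𝔼 x, headDiff f x ^ 2 + (cubeEnergy (headMean f) + cubeEnergy (headDiff f)) := by
  rw [cubeEnergy_succ, Finset.mul_expect]
  congr 1
  · exact Finset.expect_congr rfl fun x _ => by rw [headDiff]; ring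
  · simp only [cubeEnergy, ← Finset.sum_add_distrib, Finset.sum_div, ← Finset.expect_add_distrib,
      Finset.expect_div]
    exact Finset.sum_congr rfl fun i _ => Finset.expect_congr rfl fun x _ => by
      simp only [bitDeriv, headMean, headDiff]; ring

theorem expect_abs_bitDeriv_zero {N : ℕ} (f : (Fin (N + 1) → Fin 2) → ℝ) :
    𝔼 x, |bitDeriv f 0 x| = 2 * 𝔼 x, |headDiff f x| := by
  simp only [cube_expect_succ, bitDeriv_zero_cons, add_self_div_two, headDiff, abs_div, abs_two,
    ← Finset.expect_div]
  ring

theorem expect_abs_bitDeriv_headMean_le {N : ℕ} (f : (Fin (N + 1) → Fin 2) → ℝ) (i : Fin N) :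
    𝔼 x, |bitDeriv (headMean f) i x| ≤ 𝔼 x, |bitDeriv f i.succ x| := by
  rw [cube_expect_succ, ← Finset.expect_add_distrib, Finset.expect_div]
  refine Finset.expect_le_expect fun x _ => ?_
  have h : bitDeriv (headMean f) i x =
      (bitDeriv f i.succ (Fin.cons 0 x) + bitDeriv f i.succ (Fin.cons 1 x)) / 2 := by
    rw [bitDeriv_succ_cons, bitDeriv_succ_cons]
    simp only [bitDeriv, headMean]
    ring
  rw [h, abs_div, abs_two]
  gcongr
  exact abs_add_le _ _

theorem uniformVar_mul_le_cubeEnergy_add_fin {N : ℕ} (f : (Fin N → Fin 2) → ℝ) {K : ℝ}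
    (hK : 0 < K) :
    uniformVar f * (1 - Real.log K) ≤
      cubeEnergy f + (∑ i, (𝔼 x, |bitDeriv f i x|) ^ 2) / K := by
  induction N with
  | zero => simp [uniformVar, cubeEnergy]
  | succ N ih =>
    have head := (expect_sq_mul_le_uniformEnt_sq_add (headDiff f) hK).trans
      (add_le_add_left (uniformEnt_sq_le_cubeEnergy (headDiff f)) _)
    have head_deriv : (𝔼 x, |headDiff f x|) ^ 2 / K ≤ (𝔼 x, |bitDeriv f 0 x|) ^ 2 / K := by
      have := expect_abs_nonneg (headDiff f)
      rw [expect_abs_bitDeriv_zero]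
      gcongr
      linarith
    have tail_deriv : (∑ i, (𝔼 x, |bitDeriv (headMean f) i x|) ^ 2) / K ≤
        (∑ i : Fin N, (𝔼 x, |bitDeriv f i.succ x|) ^ 2) / K := by
      gcongr with i
      exact expect_abs_bitDeriv_headMean_le f i
    rw [uniformVar_cube_succ, cubeEnergy_succ_eq_headMean_add_headDiff, Fin.sum_univ_succ, add_mul,
      add_div]
    linarith [ih (headMean f), expect_sq_nonneg (headDiff f)]

variable {B : Type*} [Fintype B] [DecidableEq B]

theorem uniformVar_mul_le_cubeEnergy_add (f : (B → Fin 2) → ℝ) {K : ℝ} (hK : 0 < K) :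
    uniformVar f * (1 - Real.log K) ≤
      cubeEnergy f + (∑ i, (𝔼 x, |bitDeriv f i x|) ^ 2) / K := by
  let σ := Fintype.equivFin B
  let τ : (Fin (Fintype.card B) → Fin 2) ≃ (B → Fin 2) := σ.symm.arrowCongr (Equiv.refl _)
  have expect_τ (g : (B → Fin 2) → ℝ) : 𝔼 x, g (τ x) = 𝔼 x, g x :=
    Fintype.expect_equiv τ _ _ fun _ => rfl
  have bitDeriv_τ (i : B) (x) : bitDeriv (fun x => f (τ x)) (σ i) x = bitDeriv f i (τ x) := by
    have update_τ (b : Fin 2) : τ (Function.update x (σ i) b) = Function.update (τ x) i b :=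
      Function.update_comp_eq_of_injective x σ.injective i b
    simp only [bitDeriv, update_τ]
  have key := uniformVar_mul_le_cubeEnergy_add_fin (fun x => f (τ x)) hK
  simp only [uniformVar, cubeEnergy, ← σ.sum_comp, bitDeriv_τ] at key
  simpa only [uniformVar, cubeEnergy, expect_τ fun x => f x ^ 2, expect_τ f,
    fun i => expect_τ fun x => bitDeriv f i x ^ 2, fun i => expect_τ fun x => |bitDeriv f i x|]
    using key

theorem uniformVar_mul_log_le (f : (B → Fin 2) → ℝ) {δ : ℝ} (hδ : 0 < δ)
    (hf : ∀ i, 𝔼 x, |bitDeriv f i x| ≤ δ) :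
    uniformVar f * Real.log (1 / δ) ≤ 2 * (cubeEnergy f + ∑ i, 𝔼 x, |bitDeriv f i x|) := by
  have sum_sq_le : (∑ i, (𝔼 x, |bitDeriv f i x|) ^ 2) / √δ ≤ √δ * ∑ i, 𝔼 x, |bitDeriv f i x| := by
    rw [div_le_iff₀ (Real.sqrt_pos.2 hδ), mul_right_comm, Real.mul_self_sqrt hδ.le, Finset.mul_sum]
    refine Finset.sum_le_sum fun i _ => ?_
    rw [sq]
    exact mul_le_mul_of_nonneg_right (hf i) (expect_abs_nonneg _)
  have hsum : 0 ≤ ∑ i, 𝔼 x, |bitDeriv f i x| := Finset.sum_nonneg fun i _ => expect_abs_nonneg _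
  have henergy : 0 ≤ cubeEnergy f := Finset.sum_nonneg fun i _ => expect_sq_nonneg _
  have hvar := uniformVar_nonneg f
  rw [one_div, Real.log_inv]
  rcases le_total δ 1 with hδ1 | hδ1
  · have key := uniformVar_mul_le_cubeEnergy_add f (Real.sqrt_pos.2 hδ)
    rw [Real.log_sqrt hδ.le] at key
    linarith [mul_le_of_le_one_left hsum (Real.sqrt_le_one.2 hδ1)]
  · linarith [mul_nonneg hvar (Real.log_nonneg hδ1)]

end Cube

section Line

variable {E T : Type*} [DecidableEq E]

/-- The slice of `A` along the line through `t` in the direction `e`, parametrised by the value of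
the coordinate `e`. -/
def lineSlice (A : Set (E → T)) (e : E) (t : E → T) : Set T :=
  Function.update t e ⁻¹' A

/-- The points whose line in the direction `e` meets both `A` and its complement. -/
def lineBoundary (A : Set (E → T)) (e : E) : Set (E → T) :=
  {t | (lineSlice A e t).Nonempty ∧ (lineSlice A e t)ᶜ.Nonempty}

theorem lineSlice_update (A : Set (E → T)) (e : E) (t : E → T) (i : T) :
    lineSlice A e (Function.update t e i) = lineSlice A e t := by
  ext j
  simp [lineSlice]

theorem mem_lineSlice_update_comm {A : Set (E → T)} {e f : E} (hef : e ≠ f) {t : E → T} {i j : T} :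
    i ∈ lineSlice A e (Function.update t f j) ↔ j ∈ lineSlice A f (Function.update t e i) := by
  rw [lineSlice, lineSlice, Set.mem_preimage, Set.mem_preimage, Function.update_comm hef]

theorem lineSlice_lineBoundary (A : Set (E → T)) {e f : E} (hef : e ≠ f) (t : E → T) :
    lineSlice (lineBoundary A f) e t =
      (⋃ j, lineSlice A e (Function.update t f j)) \
        ⋂ j, lineSlice A e (Function.update t f j) := by
  ext i
  simp only [Set.mem_sdiff, Set.mem_iUnion, Set.mem_iInter, not_forall,
    mem_lineSlice_update_comm hef]
  rfl

variable [Fintype E] [Fintype T]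

theorem expect_expect_update (e : E) (g : (E → T) → ℝ) :
    𝔼 t, 𝔼 i, g (Function.update t e i) = 𝔼 t, g t := by
  have swap : Function.Involutive
      fun p : (E → T) × T => (Function.update p.1 e p.2, p.1 e) := by
    rintro ⟨t, i⟩
    simp
  calc 𝔼 t, 𝔼 i, g (Function.update t e i)
      = 𝔼 p : (E → T) × T, g (Function.update p.1 e p.2) := by
        rw [← Finset.univ_product_univ, Finset.expect_product]
    _ = 𝔼 p : (E → T) × T, g p.1 := Fintype.expect_equiv swap.toPerm _ _ fun _ => rfl
    _ = 𝔼 t, 𝔼 _i : T, g t := by rw [← Finset.univ_product_univ, Finset.expect_product]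
    _ = 𝔼 t, g t := Finset.expect_congr rfl fun t _ =>
        have : Nonempty T := ⟨t e⟩
        Fintype.expect_const _

theorem uniformDensity_eq_expect_lineSlice (A : Set (E → T)) (e : E) :
    uniformDensity A = 𝔼 t, uniformDensity (lineSlice A e t) :=
  (expect_expect_update e _).symm

end Line

section CubeSet

variable {B : Type*} [DecidableEq B]

theorem abs_bitDeriv_indicator (A : Set (B → Fin 2)) (i : B) (x : B → Fin 2) :
    |bitDeriv (A.indicator 1) i x| = (lineBoundary A i).indicator 1 x := by
  by_cases h0 : Function.update x i 0 ∈ A <;> by_cases h1 : Function.update x i 1 ∈ A <;>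
    simp [bitDeriv, lineBoundary, lineSlice, Set.Nonempty, h0, h1]

theorem expect_abs_bitDeriv_indicator [Fintype B] (A : Set (B → Fin 2)) (i : B) :
    𝔼 x, |bitDeriv (A.indicator 1) i x| = uniformDensity (lineBoundary A i) :=
  Finset.expect_congr rfl fun x _ => abs_bitDeriv_indicator A i x

theorem cubeEnergy_indicator [Fintype B] (A : Set (B → Fin 2)) :
    cubeEnergy (A.indicator 1) = ∑ i, uniformDensity (lineBoundary A i) :=
  Finset.sum_congr rfl fun i _ => Finset.expect_congr rfl fun x _ => by
    rw [← sq_abs, abs_bitDeriv_indicator]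
    by_cases hx : x ∈ lineBoundary A i <;> simp [hx]

theorem uniformDensity_mul_log_le_of_cube [Fintype B] (A : Set (B → Fin 2)) {δ : ℝ} (hδ : 0 < δ)
    (hA : ∀ i, uniformDensity (lineBoundary A i) ≤ δ) :
    uniformDensity A * (1 - uniformDensity A) * Real.log (1 / δ) ≤
      4 * ∑ i, uniformDensity (lineBoundary A i) := by
  have key := uniformVar_mul_log_le (A.indicator 1) hδ fun i =>
    (expect_abs_bitDeriv_indicator A i).trans_le (hA i)
  simp only [uniformVar_indicator, cubeEnergy_indicator, expect_abs_bitDeriv_indicator] at key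
  linarith

end CubeSet

section Compression

variable {N : ℕ}

/-- The initial segment of `Fin N` with as many elements as `S`. -/
def pushDown (S : Set (Fin N)) : Set (Fin N) :=
  {i | (i : ℕ) < S.ncard}

theorem ncard_pushDown (S : Set (Fin N)) : (pushDown S).ncard = S.ncard := by
  have hS : S.ncard ≤ N := by simpa using Set.ncard_le_card S
  rw [pushDown, Set.ncard_eq_toFinset_card', Set.toFinset_ofPred, Fin.card_filter_val_lt,
    min_eq_right hS]

theorem uniformDensity_pushDown (S : Set (Fin N)) :
    uniformDensity (pushDown S) = uniformDensity S := by
  rw [uniformDensity_eq_ncard_div, uniformDensity_eq_ncard_div, ncard_pushDown]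

theorem pushDown_subset_pushDown {S S' : Set (Fin N)} (h : S.ncard ≤ S'.ncard) :
    pushDown S ⊆ pushDown S' :=
  fun _ hi => lt_of_lt_of_le hi h

theorem isLowerSet_pushDown (S : Set (Fin N)) : IsLowerSet (pushDown S) :=
  fun _ j hij hi => show (j : ℕ) < S.ncard from lt_of_le_of_lt hij hi

theorem pushDown_eq_self_of_isLowerSet {S : Set (Fin N)} (hS : IsLowerSet S) : pushDown S = S := by
  refine (Set.eq_of_subset_of_ncard_le (fun i hi => ?_) (ncard_pushDown S).le).symm
  have card_Iic : (Set.Iic i).ncard = i + 1 := by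
    rw [Set.ncard_eq_toFinset_card', Set.toFinset_Iic, Fin.card_Iic]
  have := Set.ncard_le_ncard (hS.Iic_subset hi)
  simp only [pushDown, Set.mem_ofPred_eq]
  omega

theorem nonempty_of_nonempty_pushDown {S : Set (Fin N)} (h : (pushDown S).Nonempty) :
    S.Nonempty := by
  rw [← Set.ncard_pos] at h ⊢
  rwa [ncard_pushDown] at h

theorem nonempty_compl_of_nonempty_compl_pushDown {S : Set (Fin N)} (h : (pushDown S)ᶜ.Nonempty) :
    Sᶜ.Nonempty := by
  rw [← Set.ncard_pos, Set.ncard_compl] at h ⊢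
  rwa [ncard_pushDown] at h

/-- The union and the intersection of initial segments are the longest and the shortest of them. -/
theorem ncard_iUnion_diff_iInter_pushDown_le {J : Type*} [Finite J] (L : J → Set (Fin N)) :
    ((⋃ j, pushDown (L j)) \ ⋂ j, pushDown (L j)).ncard ≤ ((⋃ j, L j) \ ⋂ j, L j).ncard := by
  rcases isEmpty_or_nonempty J with hJ | hJ
  · simp
  obtain ⟨jmax, hmax⟩ := Finite.exists_max fun j => (L j).ncard
  obtain ⟨jmin, hmin⟩ := Finite.exists_min fun j => (L j).ncard
  calc ((⋃ j, pushDown (L j)) \ ⋂ j, pushDown (L j)).ncard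
      ≤ (pushDown (L jmax) \ pushDown (L jmin)).ncard :=
        Set.ncard_le_ncard <| Set.sdiff_subset_sdiff
          (Set.iUnion_subset fun j => pushDown_subset_pushDown (hmax j))
          (Set.subset_iInter fun j => pushDown_subset_pushDown (hmin j))
    _ = (L jmax).ncard - (L jmin).ncard := by
        rw [Set.ncard_sdiff (pushDown_subset_pushDown (hmin jmax)), ncard_pushDown, ncard_pushDown]
    _ ≤ (L jmax \ L jmin).ncard := Set.le_ncard_sdiff _ _
    _ ≤ ((⋃ j, L j) \ ⋂ j, L j).ncard :=
        Set.ncard_le_ncard <|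
          Set.sdiff_subset_sdiff (Set.subset_iUnion L jmax) (Set.iInter_subset L jmin)

variable {E : Type*} [DecidableEq E]

/-- The compression of `A` in the direction `e`: each slice of `A` in this direction is replaced by
the initial segment of the same size. -/
def compress (A : Set (E → Fin N)) (e : E) : Set (E → Fin N) :=
  {t | t e ∈ pushDown (lineSlice A e t)}

theorem lineSlice_compress (A : Set (E → Fin N)) (e : E) (t : E → Fin N) :
    lineSlice (compress A e) e t = pushDown (lineSlice A e t) := by
  ext i
  change Function.update t e i e ∈ pushDown (lineSlice A e (Function.update t e i)) ↔ _
  rw [Function.update_self, lineSlice_update]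

theorem mem_lineSlice_compress_of_ne {A : Set (E → Fin N)} {e f : E} (hef : e ≠ f)
    {t : E → Fin N} {i : Fin N} :
    i ∈ lineSlice (compress A e) f t ↔ t e ∈ pushDown (lineSlice A e (Function.update t f i)) := by
  change Function.update t f i e ∈ pushDown (lineSlice A e (Function.update t f i)) ↔ _
  rw [Function.update_of_ne hef]

theorem isLowerSet_lineSlice_compress (A : Set (E → Fin N)) (e : E) (t : E → Fin N) :
    IsLowerSet (lineSlice (compress A e) e t) := by
  rw [lineSlice_compress]
  exact isLowerSet_pushDown _

theorem isLowerSet_lineSlice_compress_of_ne {A : Set (E → Fin N)} {e f : E} (hef : e ≠ f)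
    (hA : ∀ t, IsLowerSet (lineSlice A f t)) (t : E → Fin N) :
    IsLowerSet (lineSlice (compress A e) f t) := by
  intro i j hij hi
  rw [mem_lineSlice_compress_of_ne hef] at hi ⊢
  refine pushDown_subset_pushDown (Set.ncard_le_ncard fun k hk => ?_) hi
  rw [mem_lineSlice_update_comm hef] at hk ⊢
  exact hA _ hij hk

variable [Fintype E]

theorem uniformDensity_compress (A : Set (E → Fin N)) (e : E) :
    uniformDensity (compress A e) = uniformDensity A := by
  rw [uniformDensity_eq_expect_lineSlice _ e, uniformDensity_eq_expect_lineSlice A e]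
  exact Finset.expect_congr rfl fun t _ => by rw [lineSlice_compress, uniformDensity_pushDown]

theorem uniformDensity_lineBoundary_compress_le (A : Set (E → Fin N)) (e f : E) :
    uniformDensity (lineBoundary (compress A e) f) ≤ uniformDensity (lineBoundary A f) := by
  rcases eq_or_ne e f with rfl | hef
  · refine uniformDensity_mono fun t ht => ?_
    rw [lineBoundary, Set.mem_ofPred_eq, lineSlice_compress] at ht
    exact ⟨nonempty_of_nonempty_pushDown ht.1, nonempty_compl_of_nonempty_compl_pushDown ht.2⟩
  rw [uniformDensity_eq_expect_lineSlice _ e, uniformDensity_eq_expect_lineSlice _ e]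
  refine Finset.expect_le_expect fun t _ => ?_
  rw [uniformDensity_eq_ncard_div, uniformDensity_eq_ncard_div, lineSlice_lineBoundary _ hef,
    lineSlice_lineBoundary _ hef]
  simp only [lineSlice_compress]
  exact div_le_div_of_nonneg_right
    (Nat.cast_le.2 (ncard_iUnion_diff_iInter_pushDown_le _)) (Nat.cast_nonneg _)

theorem exists_isLowerSet_lineSlice (A : Set (E → Fin N)) :
    ∃ A' : Set (E → Fin N), uniformDensity A' = uniformDensity A ∧
      (∀ e, uniformDensity (lineBoundary A' e) ≤ uniformDensity (lineBoundary A e)) ∧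
      ∀ e t, IsLowerSet (lineSlice A' e t) := by
  suffices h : ∀ S : Finset E, ∃ A' : Set (E → Fin N), uniformDensity A' = uniformDensity A ∧
      (∀ e, uniformDensity (lineBoundary A' e) ≤ uniformDensity (lineBoundary A e)) ∧
      ∀ e ∈ S, ∀ t, IsLowerSet (lineSlice A' e t) by
    simpa using h Finset.univ
  intro S
  induction S using Finset.induction_on with
  | empty => exact ⟨A, rfl, fun _ => le_rfl, by simp⟩
  | insert e S _ ih =>
    obtain ⟨A', hdensity, hboundary, hlower⟩ := ih
    refine ⟨compress A' e, (uniformDensity_compress A' e).trans hdensity,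
      fun f => (uniformDensity_lineBoundary_compress_le A' e f).trans (hboundary f),
      fun f hf => ?_⟩
    rcases eq_or_ne e f with rfl | hef
    · exact isLowerSet_lineSlice_compress A' e
    · exact isLowerSet_lineSlice_compress_of_ne hef
        (hlower f (Finset.mem_of_mem_insert_of_ne hf hef.symm))

end Compression

section Digits

variable {k : ℕ}

theorem val_finFunctionFinEquiv_update (x : Fin k → Fin 2) (j : Fin k) (b : Fin 2) :
    (finFunctionFinEquiv (Function.update x j b) : ℕ) + x j * 2 ^ (j : ℕ) =
      finFunctionFinEquiv x + b * 2 ^ (j : ℕ) := by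
  have others : ∑ i ∈ Finset.univ.erase j, (Function.update x j b i : ℕ) * 2 ^ (i : ℕ) =
      ∑ i ∈ Finset.univ.erase j, (x i : ℕ) * 2 ^ (i : ℕ) :=
    Finset.sum_congr rfl fun i hi => by rw [Function.update_of_ne (Finset.ne_of_mem_erase hi)]
  rw [finFunctionFinEquiv_apply, finFunctionFinEquiv_apply,
    ← Finset.add_sum_erase _ _ (Finset.mem_univ j), others, Function.update_self,
    ← Finset.add_sum_erase _ _ (Finset.mem_univ j)]
  ring

theorem val_finFunctionFinEquiv_update_le (x : Fin k → Fin 2) (j : Fin k) (b : Fin 2) :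
    (finFunctionFinEquiv (Function.update x j b) : ℕ) ≤ finFunctionFinEquiv x + 2 ^ (j : ℕ) := by
  have digit_le := Nat.mul_le_mul_right (2 ^ (j : ℕ)) (Nat.le_of_lt_succ b.2)
  linarith [val_finFunctionFinEquiv_update x j b, Nat.zero_le (x j * 2 ^ (j : ℕ))]

theorem val_finFunctionFinEquiv_le_update_add (x : Fin k → Fin 2) (j : Fin k) (b : Fin 2) :
    (finFunctionFinEquiv x : ℕ) ≤ finFunctionFinEquiv (Function.update x j b) + 2 ^ (j : ℕ) := by
  simpa using val_finFunctionFinEquiv_update_le (Function.update x j b) j (x j)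

/-- If changing the digit `j` of `n` crosses the end of the initial segment `S`, then `n` is within
`2 ^ j` of that end. -/
theorem uniformDensity_lineBoundary_digit_le {S : Set (Fin (2 ^ k))} (hS : IsLowerSet S)
    (j : Fin k) :
    uniformDensity (lineBoundary (finFunctionFinEquiv ⁻¹' S) j) ≤ 2 * 2 ^ (j : ℕ) / 2 ^ k := by
  have near_end : ∀ x ∈ lineBoundary (finFunctionFinEquiv ⁻¹' S) j,
      (finFunctionFinEquiv x : ℕ) ∈
        Set.Ico (S.ncard - 2 ^ (j : ℕ)) (S.ncard + 2 ^ (j : ℕ)) := by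
    rw [← pushDown_eq_self_of_isLowerSet hS, ncard_pushDown]
    rintro x ⟨⟨b, hb⟩, b', hb'⟩
    have hb : (finFunctionFinEquiv (Function.update x j b) : ℕ) < S.ncard := hb
    have hb' : S.ncard ≤ finFunctionFinEquiv (Function.update x j b') := not_lt.1 hb'
    exact ⟨Nat.sub_le_of_le_add (hb'.trans (val_finFunctionFinEquiv_update_le x j b')),
      (val_finFunctionFinEquiv_le_update_add x j b).trans_lt (Nat.add_lt_add_right hb _)⟩
  have card_le : (lineBoundary (finFunctionFinEquiv ⁻¹' S) j).ncard ≤ 2 * 2 ^ (j : ℕ) :=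
    calc (lineBoundary (finFunctionFinEquiv ⁻¹' S) j).ncard
        ≤ (Set.Ico (S.ncard - 2 ^ (j : ℕ)) (S.ncard + 2 ^ (j : ℕ))).ncard :=
          Set.ncard_le_ncard_of_injOn _ near_end
            (Fin.val_injective.comp finFunctionFinEquiv.injective).injOn
      _ ≤ 2 * 2 ^ (j : ℕ) := by
          rw [Set.ncard_eq_toFinset_card', Set.toFinset_Ico, Nat.card_Ico]
          omega
  rw [uniformDensity_eq_ncard_div]
  simp only [Fintype.card_fun, Fintype.card_fin, Nat.cast_pow, Nat.cast_ofNat]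
  gcongr
  exact_mod_cast card_le

theorem sum_uniformDensity_lineBoundary_digit_le {S : Set (Fin (2 ^ k))} (hS : IsLowerSet S) :
    ∑ j, uniformDensity (lineBoundary (finFunctionFinEquiv ⁻¹' S) j) ≤ 2 := by
  have geom : ∑ j : Fin k, (2 : ℝ) ^ (j : ℕ) = 2 ^ k - 1 := by
    rw [Fin.sum_univ_eq_sum_range (fun j => (2 : ℝ) ^ j), geom_sum_eq (by norm_num)]
    norm_num
  calc ∑ j, uniformDensity (lineBoundary (finFunctionFinEquiv ⁻¹' S) j)
      ≤ ∑ j : Fin k, 2 * 2 ^ (j : ℕ) / 2 ^ k :=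
        Finset.sum_le_sum fun j _ => uniformDensity_lineBoundary_digit_le hS j
    _ = 2 * (2 ^ k - 1) / 2 ^ k := by rw [← Finset.sum_div, ← Finset.mul_sum, geom]
    _ ≤ 2 := div_le_of_le_mul₀ (by positivity) (by norm_num) (by linarith)

variable {E : Type*}

/-- The equivalence between the cube and a dyadic grid that reads blocks of `k` bits as binary
expansions. -/
def digitsEquiv (E : Type*) (k : ℕ) : (E × Fin k → Fin 2) ≃ (E → Fin (2 ^ k)) :=
  (Equiv.curry E (Fin k) (Fin 2)).trans (Equiv.piCongrRight fun _ => finFunctionFinEquiv)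

variable [DecidableEq E]

theorem digitsEquiv_update (x : E × Fin k → Fin 2) (e : E) (j : Fin k) (b : Fin 2) :
    digitsEquiv E k (Function.update x (e, j) b) =
      Function.update (digitsEquiv E k x) e
        (finFunctionFinEquiv (Function.update (fun i => x (e, i)) j b)) := by
  change finFunctionFinEquiv ∘ Function.curry (Function.update x (e, j) b) = _
  rw [Function.curry_update, Function.comp_update]
  rfl

theorem lineSlice_preimage_digitsEquiv (A : Set (E → Fin (2 ^ k))) (e : E) (j : Fin k)
    (x : E × Fin k → Fin 2) :
    lineSlice (digitsEquiv E k ⁻¹' A) (e, j) x =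
      lineSlice (finFunctionFinEquiv ⁻¹' lineSlice A e (digitsEquiv E k x)) j
        fun i => x (e, i) := by
  ext b
  simp only [lineSlice, Set.mem_preimage, digitsEquiv_update]

theorem lineBoundary_digit_eq_empty {A : Set (E → Fin (2 ^ k))} {e : E} {t : E → Fin (2 ^ k)}
    (ht : t ∉ lineBoundary A e) (j : Fin k) :
    lineBoundary (finFunctionFinEquiv ⁻¹' lineSlice A e t) j = ∅ :=
  Set.eq_empty_of_forall_notMem fun _ hx => ht ⟨⟨_, hx.1.some_mem⟩, ⟨_, hx.2.some_mem⟩⟩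

variable [Fintype E]

theorem uniformDensity_lineBoundary_preimage_digitsEquiv (A : Set (E → Fin (2 ^ k))) (e : E)
    (j : Fin k) :
    uniformDensity (lineBoundary (digitsEquiv E k ⁻¹' A) (e, j)) =
      𝔼 t, uniformDensity (lineBoundary (finFunctionFinEquiv ⁻¹' lineSlice A e t) j) := by
  let A_j : Set (E → Fin (2 ^ k)) := {t | finFunctionFinEquiv.symm (t e) ∈
    lineBoundary (finFunctionFinEquiv ⁻¹' lineSlice A e t) j}
  have preimage : digitsEquiv E k ⁻¹' A_j = lineBoundary (digitsEquiv E k ⁻¹' A) (e, j) := by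
    ext x
    have digits_e : finFunctionFinEquiv.symm (digitsEquiv E k x e) = fun i => x (e, i) :=
      finFunctionFinEquiv.symm_apply_apply _
    simp only [A_j, lineBoundary, Set.mem_preimage, Set.mem_ofPred_eq, digits_e,
      lineSlice_preimage_digitsEquiv]
  have slice (t) : lineSlice A_j e t = finFunctionFinEquiv.symm ⁻¹'
      lineBoundary (finFunctionFinEquiv ⁻¹' lineSlice A e t) j := by
    ext i
    simp only [lineSlice, A_j, Set.mem_preimage, Set.mem_ofPred_eq, Function.update_self]
    rw [← lineSlice, ← lineSlice, lineSlice_update]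
  rw [← preimage, uniformDensity_preimage_equiv, uniformDensity_eq_expect_lineSlice A_j e]
  exact Finset.expect_congr rfl fun t _ => by rw [slice, uniformDensity_preimage_equiv]

theorem uniformDensity_lineBoundary_preimage_digitsEquiv_le (A : Set (E → Fin (2 ^ k))) (e : E)
    (j : Fin k) :
    uniformDensity (lineBoundary (digitsEquiv E k ⁻¹' A) (e, j)) ≤
      uniformDensity (lineBoundary A e) := by
  rw [uniformDensity_lineBoundary_preimage_digitsEquiv]
  refine Finset.expect_le_expect fun t _ => ?_
  by_cases ht : t ∈ lineBoundary A e
  · simpa [ht] using uniformDensity_le_one _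
  · simp [lineBoundary_digit_eq_empty ht, uniformDensity, ht]

theorem sum_uniformDensity_lineBoundary_preimage_digitsEquiv_le {A : Set (E → Fin (2 ^ k))} {e : E}
    (hA : ∀ t, IsLowerSet (lineSlice A e t)) :
    ∑ j, uniformDensity (lineBoundary (digitsEquiv E k ⁻¹' A) (e, j)) ≤
      2 * uniformDensity (lineBoundary A e) := by
  simp only [uniformDensity_lineBoundary_preimage_digitsEquiv]
  rw [← Finset.expect_sum_comm, uniformDensity, Finset.mul_expect]
  refine Finset.expect_le_expect fun t _ => ?_
  by_cases ht : t ∈ lineBoundary A e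
  · simpa [ht] using sum_uniformDensity_lineBoundary_digit_le (hA t)
  · simp [lineBoundary_digit_eq_empty ht, uniformDensity, ht]

theorem uniformDensity_mul_log_le_of_dyadicGrid (A : Set (E → Fin (2 ^ k))) {δ : ℝ} (hδ : 0 < δ)
    (hA : ∀ e, uniformDensity (lineBoundary A e) ≤ δ) :
    uniformDensity A * (1 - uniformDensity A) * Real.log (1 / δ) ≤
      8 * ∑ e, uniformDensity (lineBoundary A e) := by
  obtain ⟨A', hdensity, hboundary, hlower⟩ := exists_isLowerSet_lineSlice A
  have key := uniformDensity_mul_log_le_of_cube (digitsEquiv E k ⁻¹' A') hδ fun i =>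
    (uniformDensity_lineBoundary_preimage_digitsEquiv_le A' i.1 i.2).trans
      ((hboundary i.1).trans (hA i.1))
  rw [uniformDensity_preimage_equiv, hdensity, Fintype.sum_prod_type] at key
  calc uniformDensity A * (1 - uniformDensity A) * Real.log (1 / δ)
      ≤ 4 * ∑ e, ∑ j, uniformDensity (lineBoundary (digitsEquiv E k ⁻¹' A') (e, j)) := key
    _ ≤ 4 * ∑ e, 2 * uniformDensity (lineBoundary A e) := by
        gcongr with e
        exact (sum_uniformDensity_lineBoundary_preimage_digitsEquiv_le (hlower e)).trans
          (mul_le_mul_of_nonneg_left (hboundary e) zero_le_two)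
    _ = 8 * ∑ e, uniformDensity (lineBoundary A e) := by
        rw [← Finset.mul_sum]
        ring

end Digits

section SecondMoment

open MeasureTheory ProbabilityTheory

variable {Ω ι : Type*} [MeasurableSpace Ω] {μ : Measure Ω} [IsProbabilityMeasure μ]

theorem memLp_indicator_one {S : Set Ω} (hS : MeasurableSet S) :
    MemLp (S.indicator (1 : Ω → ℝ)) 2 μ :=
  memLp_indicator_const 2 hS 1 (Or.inr (measure_ne_top μ S))

theorem covariance_indicator_one {S S' : Set Ω} (hS : MeasurableSet S) (hS' : MeasurableSet S') :
    cov[S.indicator (1 : Ω → ℝ), S'.indicator (1 : Ω → ℝ); μ] =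
      μ.real (S ∩ S') - μ.real S * μ.real S' := by
  rw [covariance_eq_sub (memLp_indicator_one hS) (memLp_indicator_one hS'),
    ← Set.inter_indicator_one, integral_indicator_one (hS.inter hS'), integral_indicator_one hS,
    integral_indicator_one hS']

theorem covariance_indicator_one_le_one {S S' : Set Ω} (hS : MeasurableSet S)
    (hS' : MeasurableSet S') : cov[S.indicator (1 : Ω → ℝ), S'.indicator (1 : Ω → ℝ); μ] ≤ 1 := by
  rw [covariance_indicator_one hS hS']
  exact (sub_le_self _ (mul_nonneg measureReal_nonneg measureReal_nonneg)).trans measureReal_le_one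

theorem covariance_indicator_one_eq_zero {S S' : Set Ω} (hS : MeasurableSet S)
    (hS' : MeasurableSet S') (h : IndepSet S S' μ) :
    cov[S.indicator (1 : Ω → ℝ), S'.indicator (1 : Ω → ℝ); μ] = 0 := by
  rw [covariance_indicator_one hS hS', measureReal_def, h.measure_inter_eq_mul, ENNReal.toReal_mul]
  exact sub_self _

variable [Fintype ι]

theorem memLp_uniformDensity {S : ι → Set Ω} (hS : ∀ i, MeasurableSet (S i)) :
    MemLp (fun ω => uniformDensity {i | ω ∈ S i}) 2 μ := by
  simp only [uniformDensity_setOf_mem, Fintype.expect_eq_sum_div_card, div_eq_inv_mul]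
  exact (memLp_finsetSum _ fun i _ => memLp_indicator_one (hS i)).const_mul _

theorem integral_uniformDensity {S : ι → Set Ω} (hS : ∀ i, MeasurableSet (S i)) :
    ∫ ω, uniformDensity {i | ω ∈ S i} ∂μ = 𝔼 i, μ.real (S i) := by
  simp only [uniformDensity_setOf_mem, Fintype.expect_eq_sum_div_card]
  rw [integral_div,
    integral_finsetSum _ fun i _ => (memLp_indicator_one (hS i)).integrable one_le_two]
  simp only [integral_indicator_one (hS _)]

theorem variance_uniformDensity {S : ι → Set Ω} (hS : ∀ i, MeasurableSet (S i)) :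
    Var[fun ω => uniformDensity {i | ω ∈ S i}; μ] =
      𝔼 i, 𝔼 j, cov[(S i).indicator (1 : Ω → ℝ), (S j).indicator (1 : Ω → ℝ); μ] := by
  simp only [uniformDensity_setOf_mem, Fintype.expect_eq_sum_div_card, div_eq_inv_mul]
  rw [variance_const_mul, variance_fun_sum fun i => memLp_indicator_one (hS i)]
  simp only [← Finset.mul_sum]
  ring

theorem variance_uniformDensity_le {S : ι → Set Ω} (hS : ∀ i, MeasurableSet (S i)) {c : ℝ}
    (hc : ∀ i, uniformDensity {j | ¬ IndepSet (S i) (S j) μ} ≤ c) [Nonempty ι] :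
    Var[fun ω => uniformDensity {i | ω ∈ S i}; μ] ≤ c := by
  rw [variance_uniformDensity hS]
  refine Finset.expect_le Finset.univ_nonempty fun i _ =>
    (Finset.expect_le_expect fun j _ => ?_).trans (hc i)
  by_cases h : IndepSet (S i) (S j) μ
  · simp [h, covariance_indicator_one_eq_zero (hS i) (hS j) h]
  · simpa [h] using covariance_indicator_one_le_one (hS i) (hS j)

theorem exists_forall_abs_sub_integral_le {Y : ι → Ω → ℝ} (hY : ∀ i, MemLp (Y i) 2 μ) {ε : ℝ}
    (hε : 0 ≤ ε) (hvar : ∑ i, Var[Y i; μ] ≤ ε ^ 2) {p : Ω → Prop} (hp : ∀ᵐ ω ∂μ, p ω) :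
    ∃ ω, p ω ∧ ∀ i, |Y i ω - ∫ x, Y i x ∂μ| ≤ ε := by
  have integrable_sq (i) : Integrable (fun ω => (Y i ω - ∫ x, Y i x ∂μ) ^ 2) μ :=
    ((hY i).sub (memLp_const _)).integrable_sq
  obtain ⟨ω, hpω, hω⟩ := exists_notMem_null_le_integral
    (integrable_finsetSum Finset.univ fun i _ => integrable_sq i) hp
  have sum_sq_le : ∑ i, (Y i ω - ∫ x, Y i x ∂μ) ^ 2 ≤ ε ^ 2 := by
    refine hω.trans (le_of_eq_of_le ?_ hvar)
    rw [integral_finsetSum _ fun i _ => integrable_sq i]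
    exact Finset.sum_congr rfl fun i _ => (variance_eq_integral (hY i).aemeasurable).symm
  exact ⟨ω, by simpa using hpω, fun i => abs_le_of_sq_le_sq
    ((Finset.single_le_sum (f := fun j => (Y j ω - ∫ x, Y j x ∂μ) ^ 2) (fun j _ => sq_nonneg _)
      (Finset.mem_univ i)).trans sum_sq_le) hε⟩

end SecondMoment

section Sampling

open MeasureTheory ProbabilityTheory

theorem iIndepFun_eval_pi {κ : Type*} [Fintype κ] {X : κ → Type*} [∀ j, MeasurableSpace (X j)]
    (μ : ∀ j, Measure (X j)) [∀ j, IsProbabilityMeasure (μ j)] :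
    iIndepFun (fun j (φ : ∀ j, X j) => φ j) (Measure.pi μ) :=
  iIndepFun_pi (X := fun _ => id) fun _ => aemeasurable_id

theorem measurePreserving_pi_comp_injective {ι κ : Type*} [Fintype ι] [Fintype κ] {X : κ → Type*}
    [∀ j, MeasurableSpace (X j)] (μ : ∀ j, Measure (X j)) [∀ j, IsProbabilityMeasure (μ j)]
    {σ : ι → κ} (hσ : Function.Injective σ) :
    MeasurePreserving (fun (φ : ∀ j, X j) i => φ (σ i)) (Measure.pi μ)
      (Measure.pi fun i => μ (σ i)) := by
  refine ⟨by fun_prop, ?_⟩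
  have indep := (iIndepFun_eval_pi μ).precomp hσ
  rw [iIndepFun_iff_map_fun_eq_pi_map fun i => (measurable_pi_apply (σ i)).aemeasurable] at indep
  rw [indep]
  congr 1
  ext1 i
  exact (measurePreserving_eval μ (σ i)).map_eq

variable {Ω E T : Type*}

/-- The configuration picked out by `t` from an array `φ` with one row of samples for each element
of `E`. -/
def sampleAt (t : E → T) (φ : E × T → Ω) : E → Ω :=
  fun e => φ (e, t e)

variable [MeasurableSpace Ω] [Fintype E] [Fintype T] (P : Measure Ω) [IsProbabilityMeasure P]

theorem measurePreserving_sampleAt (t : E → T) :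
    MeasurePreserving (sampleAt t) (Measure.pi fun _ : E × T => P) (Measure.pi fun _ : E => P) :=
  measurePreserving_pi_comp_injective (fun _ => P) (σ := fun e => (e, t e))
    fun _ _ h => congrArg Prod.fst h

theorem indepFun_sampleAt {t t' : E → T} (h : ∀ e, t e ≠ t' e) :
    IndepFun (sampleAt t) (sampleAt t') (Measure.pi fun _ : E × T => P) := by
  classical
  let graph (s : E → T) : Finset (E × T) := Finset.univ.image fun e => (e, s e)
  have mem_graph (s : E → T) (e : E) : (e, s e) ∈ graph s :=
    Finset.mem_image_of_mem _ (Finset.mem_univ e)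
  have disjoint_graph : Disjoint (graph t) (graph t') := by
    simp only [graph, Finset.disjoint_left, Finset.mem_image, Finset.mem_univ, true_and]
    rintro _ ⟨e, rfl⟩ ⟨e', he'⟩
    obtain ⟨rfl, he⟩ := Prod.ext_iff.1 he'
    exact h _ he.symm
  exact ((iIndepFun_eval_pi fun _ => P).indepFun_finset _ _ disjoint_graph
      fun j => measurable_pi_apply j).comp
    (φ := fun x e => x ⟨(e, t e), mem_graph t e⟩) (ψ := fun x e => x ⟨(e, t' e), mem_graph t' e⟩)
    (by fun_prop) (by fun_prop)

theorem uniformDensity_setOf_exists_eq_le [DecidableEq E] [Nonempty T] (t : E → T) :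
    uniformDensity {t' : E → T | ∃ e, t e = t' e} ≤ Fintype.card E / Fintype.card T := by
  have density_eq (e : E) :
      uniformDensity {t' : E → T | t e = t' e} = 1 / Fintype.card T := by
    have slice (t' : E → T) : lineSlice {t' : E → T | t e = t' e} e t' = {t e} := by
      ext i
      simp [lineSlice, eq_comm]
    rw [uniformDensity_eq_expect_lineSlice _ e]
    simp only [slice, uniformDensity_eq_ncard_div, Set.ncard_singleton, Nat.cast_one,
      Fintype.expect_const]
  have union_eq : {t' : E → T | ∃ e, t e = t' e} = ⋃ e, {t' : E → T | t e = t' e} := by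
    ext t'
    simp
  calc uniformDensity {t' : E → T | ∃ e, t e = t' e}
      ≤ ∑ e, uniformDensity {t' : E → T | t e = t' e} :=
        union_eq ▸ uniformDensity_iUnion_le _
    _ = Fintype.card E / Fintype.card T := by
        simp only [density_eq, Finset.sum_const, Finset.card_univ, nsmul_eq_mul, mul_one_div]

theorem integral_uniformDensity_sampleAt [DecidableEq E] [Nonempty T] {B : Set (E → Ω)}
    (hB : MeasurableSet B) :
    ∫ φ : E × T → Ω, uniformDensity {t : E → T | sampleAt t φ ∈ B}
      ∂(Measure.pi fun _ : E × T => P) = (Measure.pi fun _ : E => P).real B := by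
  refine (integral_uniformDensity fun t => (measurePreserving_sampleAt P t).measurable hB).trans ?_
  simp only [(measurePreserving_sampleAt P _).measureReal_preimage hB.nullMeasurableSet,
    Fintype.expect_const]

theorem variance_uniformDensity_sampleAt_le [DecidableEq E] [Nonempty T] {B : Set (E → Ω)}
    (hB : MeasurableSet B) :
    Var[fun φ : E × T → Ω => uniformDensity {t : E → T | sampleAt t φ ∈ B};
      Measure.pi fun _ : E × T => P] ≤ Fintype.card E / Fintype.card T := by
  have measurable_sampleAt (t : E → T) := (measurePreserving_sampleAt P t).measurable
  refine variance_uniformDensity_le (fun t => measurable_sampleAt t hB) fun t =>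
    (uniformDensity_mono fun t' ht' => ?_).trans (uniformDensity_setOf_exists_eq_le t)
  by_contra h
  have indep := indepFun_sampleAt P fun e he => h ⟨e, he⟩
  exact ht' ((indepFun_iff_indepSet_preimage (measurable_sampleAt t) (measurable_sampleAt t')).1
    indep B B hB hB)

theorem exists_sample [DecidableEq E] [Nonempty T] {ι : Type*} [Fintype ι] {B : ι → Set (E → Ω)}
    (hB : ∀ i, MeasurableSet (B i)) {p : (E → Ω) → Prop}
    (hp : ∀ᵐ ω ∂(Measure.pi fun _ : E => P), p ω) {ε : ℝ} (hε : 0 ≤ ε)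
    (hT : Fintype.card ι * Fintype.card E ≤ ε ^ 2 * Fintype.card T) :
    ∃ φ : E × T → Ω, (∀ t : E → T, p (sampleAt t φ)) ∧
      ∀ i, |uniformDensity {t : E → T | sampleAt t φ ∈ B i} -
        (Measure.pi fun _ : E => P).real (B i)| ≤ ε := by
  have sum_variance_le : ∑ i, Var[fun φ : E × T → Ω => uniformDensity {t | sampleAt t φ ∈ B i};
      Measure.pi fun _ : E × T => P] ≤ ε ^ 2 :=
    calc _ ≤ ∑ _i : ι, (Fintype.card E / Fintype.card T : ℝ) :=
          Finset.sum_le_sum fun i _ => variance_uniformDensity_sampleAt_le P (hB i)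
      _ ≤ ε ^ 2 := by
          rw [Finset.sum_const, Finset.card_univ, nsmul_eq_mul, ← mul_div_assoc]
          exact div_le_of_le_mul₀ (Nat.cast_nonneg _) (sq_nonneg ε) hT
  obtain ⟨φ, hpφ, hφ⟩ := exists_forall_abs_sub_integral_le
    (fun i => memLp_uniformDensity fun t => (measurePreserving_sampleAt P t).measurable (hB i))
    hε sum_variance_le
    (ae_all_iff.2 fun t => (measurePreserving_sampleAt P t).quasiMeasurePreserving.ae hp)
  refine ⟨φ, hpφ, fun i => ?_⟩
  rw [← integral_uniformDensity_sampleAt (T := T) P (hB i)]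
  exact hφ i

end Sampling

section Fibre

open MeasureTheory

theorem extendAt_apply_of_ne {Ω E : Type*} [DecidableEq E] (e : E)
    (ψ : {f : E // f ≠ e} → Ω) (x : Ω) (f : {f : E // f ≠ e}) :
    extendAt e ψ x f = ψ f :=
  dif_neg f.2

variable {Ω E : Type*} [MeasurableSpace Ω] [DecidableEq E]

theorem measurable_extendAt (e : E) :
    Measurable fun p : ({f : E // f ≠ e} → Ω) × Ω => extendAt e p.1 p.2 := by
  refine measurable_pi_lambda _ fun f => ?_
  by_cases h : f = e
  · simpa only [extendAt, h, dite_true] using measurable_snd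
  · simp only [extendAt, h, dite_false]
    fun_prop

theorem measurable_measure_fibreSection (P : Measure Ω) [SFinite P] {A : Set (E → Ω)}
    (hA : MeasurableSet A) (e : E) : Measurable fun ψ => P (fibreSection A e ψ) :=
  measurable_measure_prodMk_left (measurable_extendAt e hA)

/-- The conditional probability of `A` on the fibre through `ω` in the direction `e`. -/
def fibreMeasure (P : Measure Ω) (A : Set (E → Ω)) (e : E) (ω : E → Ω) : ENNReal :=
  P (fibreSection A e fun f => ω f)

/-- The configurations whose fibre in the direction `e` is, up to null sets, neither contained in
`A` nor disjoint from it. Its probability is the influence of `e` on `A`. -/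
def fibreBoundary (P : Measure Ω) (A : Set (E → Ω)) (e : E) : Set (E → Ω) :=
  {ω | 0 < fibreMeasure P A e ω ∧ fibreMeasure P A e ω < 1}

theorem fibreMeasure_extendAt (P : Measure Ω) (A : Set (E → Ω)) (e : E)
    (ψ : {f : E // f ≠ e} → Ω) (x : Ω) :
    fibreMeasure P A e (extendAt e ψ x) = P (fibreSection A e ψ) := by
  simp only [fibreMeasure, extendAt_apply_of_ne]

theorem measurable_fibreMeasure (P : Measure Ω) [SFinite P] {A : Set (E → Ω)}
    (hA : MeasurableSet A) (e : E) : Measurable (fibreMeasure P A e) :=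
  (measurable_measure_fibreSection P hA e).comp (by fun_prop)

theorem measurableSet_fibreBoundary (P : Measure Ω) [SFinite P] {A : Set (E → Ω)}
    (hA : MeasurableSet A) (e : E) : MeasurableSet (fibreBoundary P A e) :=
  measurable_fibreMeasure P hA e measurableSet_Ioo

theorem lineBoundary_sampleAt_subset (P : Measure Ω) [IsProbabilityMeasure P] {A : Set (E → Ω)}
    {T : Type*} {φ : E × T → Ω} {e : E}
    (hφ : ∀ t : E → T, (fibreMeasure P A e (sampleAt t φ) = 0 → sampleAt t φ ∉ A) ∧
      (fibreMeasure P A e (sampleAt t φ) = 1 → sampleAt t φ ∈ A)) :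
    lineBoundary {t : E → T | sampleAt t φ ∈ A} e ⊆ {t | sampleAt t φ ∈ fibreBoundary P A e} := by
  rintro t ⟨⟨i, hi⟩, j, hj⟩
  have fibreMeasure_update (l : T) : fibreMeasure P A e (sampleAt (Function.update t e l) φ) =
      fibreMeasure P A e (sampleAt t φ) := by
    have agree (f : {f : E // f ≠ e}) : sampleAt (Function.update t e l) φ f = sampleAt t φ f := by
      simp only [sampleAt, Function.update_of_ne f.2]
    simp only [fibreMeasure, agree]
  refine ⟨pos_iff_ne_zero.2 fun h => ?_, lt_of_le_of_ne prob_le_one fun h => ?_⟩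
  · exact (hφ _).1 ((fibreMeasure_update i).trans h) hi
  · exact hj ((hφ _).2 ((fibreMeasure_update j).trans h))

variable [Fintype E]

theorem measurePreserving_extendAt (P : Measure Ω) [SigmaFinite P] (e : E) :
    MeasurePreserving (fun p : ({f : E // f ≠ e} → Ω) × Ω => extendAt e p.1 p.2)
      ((Measure.pi fun _ : {f : E // f ≠ e} => P).prod P) (Measure.pi fun _ : E => P) := by
  refine ⟨measurable_extendAt e, (Measure.pi_eq fun s hs => ?_).symm⟩
  have preimage_box : (fun p : ({f : E // f ≠ e} → Ω) × Ω => extendAt e p.1 p.2) ⁻¹'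
      Set.univ.pi s = (Set.univ.pi fun f : {f : E // f ≠ e} => s f) ×ˢ s e := by
    ext ⟨ψ, x⟩
    simp only [Set.mem_preimage, Set.mem_univ_pi, Set.mem_prod]
    refine ⟨fun h => ⟨fun f => by simpa [extendAt, f.2] using h f, by simpa [extendAt] using h e⟩,
      fun ⟨hψ, hx⟩ f => ?_⟩
    rcases eq_or_ne f e with rfl | hf
    · simpa [extendAt] using hx
    · simpa [extendAt, hf] using hψ ⟨f, hf⟩
  rw [Measure.map_apply (measurable_extendAt e) (MeasurableSet.univ_pi hs), preimage_box,
    Measure.prod_prod, Measure.pi_pi, mul_comm,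
    ← Fintype.prod_eq_mul_prod_subtype_ne (fun i => P (s i)) e]

theorem ae_pi_iff_ae_ae_extendAt (P : Measure Ω) [SigmaFinite P] (e : E) {p : (E → Ω) → Prop}
    (hp : MeasurableSet {ω | p ω}) :
    (∀ᵐ ω ∂(Measure.pi fun _ : E => P), p ω) ↔
      ∀ᵐ ψ ∂(Measure.pi fun _ : {f : E // f ≠ e} => P), ∀ᵐ x ∂P, p (extendAt e ψ x) := by
  rw [← (measurePreserving_extendAt P e).map_eq,
    ae_map_iff (measurable_extendAt e).aemeasurable hp]
  exact Measure.ae_prod_iff_ae_ae (measurable_extendAt e hp)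

variable (P : Measure Ω) [IsProbabilityMeasure P] {A : Set (E → Ω)}

theorem measureReal_fibreBoundary (hA : MeasurableSet A) (e : E) :
    (Measure.pi fun _ : E => P).real (fibreBoundary P A e) = influence P A e :=
  (measurePreserving_pi_comp_injective (fun _ : E => P)
    (σ := fun f : {f : E // f ≠ e} => (f : E)) Subtype.val_injective).measureReal_preimage
    (measurable_measure_fibreSection P hA e measurableSet_Ioo).nullMeasurableSet

theorem ae_notMem_of_fibreMeasure_eq_zero (hA : MeasurableSet A) (e : E) :
    ∀ᵐ ω ∂(Measure.pi fun _ : E => P), fibreMeasure P A e ω = 0 → ω ∉ A := by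
  have measurableSet_imp : MeasurableSet {ω | fibreMeasure P A e ω = 0 → ω ∉ A} :=
    (measurable_fibreMeasure P hA e (measurableSet_singleton 0)).imp hA.compl
  rw [ae_pi_iff_ae_ae_extendAt P e measurableSet_imp]
  refine Filter.Eventually.of_forall fun ψ => ?_
  simp only [fibreMeasure_extendAt, Filter.eventually_imp_distrib_left]
  exact fun h => measure_eq_zero_iff_ae_notMem.1 h

theorem ae_mem_of_fibreMeasure_eq_one (hA : MeasurableSet A) (e : E) :
    ∀ᵐ ω ∂(Measure.pi fun _ : E => P), fibreMeasure P A e ω = 1 → ω ∈ A := by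
  filter_upwards [ae_notMem_of_fibreMeasure_eq_zero P hA.compl e] with ω hω h
  have measurableSet_section : MeasurableSet (fibreSection A e fun f => ω f) :=
    measurable_prodMk_left (measurable_extendAt e hA)
  exact Set.notMem_compl_iff.1 (hω ((prob_compl_eq_zero_iff measurableSet_section).2 h))

theorem exists_dyadicGrid_approximation (hA : MeasurableSet A) {ε : ℝ} (hε : 0 < ε) :
    ∃ (k : ℕ) (A' : Set (E → Fin (2 ^ k))),
      |uniformDensity A' - (Measure.pi fun _ : E => P).real A| ≤ ε ∧
      ∀ e, uniformDensity (lineBoundary A' e) ≤ influence P A e + ε := by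
  obtain ⟨k, hk⟩ := pow_unbounded_of_one_lt
    ((Fintype.card (Option E) * Fintype.card E : ℝ) / ε ^ 2) one_lt_two
  rw [div_lt_iff₀' (by positivity)] at hk
  obtain ⟨φ, hae, hφ⟩ := exists_sample (T := Fin (2 ^ k)) P
    (B := fun i : Option E => i.elim A (fibreBoundary P A))
    (Option.forall.2 ⟨hA, measurableSet_fibreBoundary P hA⟩)
    (Filter.eventually_all.2 fun e => (ae_notMem_of_fibreMeasure_eq_zero P hA e).and
      (ae_mem_of_fibreMeasure_eq_one P hA e)) hε.le (by simpa using hk.le)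
  refine ⟨k, {t | sampleAt t φ ∈ A}, hφ none, fun e => ?_⟩
  calc uniformDensity (lineBoundary {t | sampleAt t φ ∈ A} e)
      ≤ uniformDensity {t : E → Fin (2 ^ k) | sampleAt t φ ∈ fibreBoundary P A e} :=
        uniformDensity_mono (lineBoundary_sampleAt_subset P fun t => hae t e)
    _ ≤ influence P A e + ε := by
        rw [← measureReal_fibreBoundary P hA e, ← sub_le_iff_le_add']
        exact (le_abs_self _).trans (hφ (some e))

end Fibre

section Influence

open MeasureTheory Filter Topology

variable {Ω E : Type*} [MeasurableSpace Ω] [DecidableEq E] [Fintype E] (P : Measure Ω)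
  [IsProbabilityMeasure P] {A : Set (E → Ω)}

theorem measureReal_mul_log_le_sum_influence (hA : MeasurableSet A) {δ : ℝ} (hδ : 0 < δ)
    (hinf : ∀ e, influence P A e ≤ δ) :
    (Measure.pi fun _ : E => P).real A * (1 - (Measure.pi fun _ : E => P).real A) *
      Real.log (1 / δ) ≤ 8 * ∑ e, influence P A e := by
  let ε (n : ℕ) : ℝ := 1 / (n + 1)
  have hε (n : ℕ) : 0 < ε n := Nat.one_div_pos_of_nat
  have tendsto_ε : Tendsto ε atTop (𝓝 0) := tendsto_one_div_add_atTop_nhds_zero_nat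
  choose k A' density_near boundary_le using
    fun n => exists_dyadicGrid_approximation P hA (hε n)
  have grid_bound (n : ℕ) : uniformDensity (A' n) * (1 - uniformDensity (A' n)) *
      Real.log (1 / (δ + ε n)) ≤ 8 * ∑ e, (influence P A e + ε n) :=
    (uniformDensity_mul_log_le_of_dyadicGrid (A' n) (add_pos hδ (hε n)) fun e =>
      (boundary_le n e).trans (add_le_add_left (hinf e) _)).trans
        (mul_le_mul_of_nonneg_left (Finset.sum_le_sum fun e _ => boundary_le n e) (by norm_num))
  have tendsto_density : Tendsto (fun n => uniformDensity (A' n)) atTop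
      (𝓝 ((Measure.pi fun _ : E => P).real A)) :=
    tendsto_iff_norm_sub_tendsto_zero.2
      (squeeze_zero (fun _ => norm_nonneg _) density_near tendsto_ε)
  have tendsto_log : Tendsto (fun n => Real.log (1 / (δ + ε n))) atTop (𝓝 (Real.log (1 / δ))) := by
    have := tendsto_ε.const_add δ
    rw [add_zero] at this
    exact (tendsto_const_nhds.div this hδ.ne').log (one_div_ne_zero hδ.ne')
  have tendsto_sum : Tendsto (fun n => 8 * ∑ e, (influence P A e + ε n)) atTop
      (𝓝 (8 * ∑ e, (influence P A e + 0))) :=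
    (tendsto_finsetSum _ fun e _ => tendsto_ε.const_add _).const_mul 8
  simp only [add_zero] at tendsto_sum
  exact le_of_tendsto_of_tendsto' ((tendsto_density.mul (tendsto_density.const_sub 1)).mul
    tendsto_log) tendsto_sum grid_bound

theorem exists_influence_pos (hA : MeasurableSet A)
    (hpos : 0 < (Measure.pi fun _ : E => P).real A)
    (hlt : (Measure.pi fun _ : E => P).real A < 1) : ∃ e, 0 < influence P A e := by
  by_contra! h
  have log_two_pos : 0 < Real.log (1 / (1 / 2)) := Real.log_pos (by norm_num)
  have lower := mul_pos (mul_pos hpos (sub_pos.2 hlt)) log_two_pos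
  have upper := measureReal_mul_log_le_sum_influence P hA one_half_pos
    fun e => (h e).trans one_half_pos.le
  linarith [Finset.sum_nonpos fun e (_ : e ∈ Finset.univ) => h e]

end Influence

theorem mul_log_le_of_mul_log_inv_le {v n m : ℝ} (hv : 0 ≤ v) (hv1 : v ≤ 1) (hn : 1 ≤ n)
    (hm : 0 < m) (h : v * Real.log (1 / m) ≤ 8 * (n * m)) : v * Real.log n ≤ 16 * (n * m) := by
  have hn0 : 0 < n := one_pos.trans_le hn
  have sqrt_pos : 0 < √n := Real.sqrt_pos.2 hn0
  rcases le_total m (1 / √n) with hsmall | hlarge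
  · have half_log_le : Real.log n / 2 ≤ Real.log (1 / m) := by
      rw [← Real.log_sqrt hn0.le]
      exact Real.log_le_log sqrt_pos ((le_one_div sqrt_pos hm).2 hsmall)
    linarith [mul_le_mul_of_nonneg_left half_log_le hv]
  · calc v * Real.log n ≤ Real.log n := mul_le_of_le_one_left (Real.log_nonneg hn) hv1
      _ ≤ 2 * √n := by
          have := Real.log_le_sub_one_of_pos sqrt_pos
          rw [Real.log_sqrt hn0.le] at this
          linarith
      _ = 2 * (n * (1 / √n)) := by rw [mul_one_div, Real.div_sqrt]
      _ ≤ 16 * (n * m) := by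
          have := mul_le_mul_of_nonneg_left hlarge hn0.le
          linarith [mul_pos hn0 hm]

theorem theorem1 :
    ∃ c c' : ℝ, 0 < c ∧ 0 < c' ∧
      ∀ (Ω : Type*) [MeasurableSpace Ω] (P : MeasureTheory.Measure Ω)
        [MeasureTheory.IsProbabilityMeasure P]
        (E : Type*) [Fintype E] [DecidableEq E] (A : Set (E → Ω)),
        MeasurableSet A →
        0 < (MeasureTheory.Measure.pi (fun _ : E => P)).real A →
        (MeasureTheory.Measure.pi (fun _ : E => P)).real A < 1 →
        (∃ m : ℝ, IsGreatest (Set.range (influence P A)) m ∧ 0 < m ∧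
          c * ((MeasureTheory.Measure.pi (fun _ : E => P)).real A *
              (1 - (MeasureTheory.Measure.pi (fun _ : E => P)).real A)) *
              Real.log (1 / (2 * m))
            ≤ ∑ e : E, influence P A e) ∧
        (∃ e : E,
          c' * ((MeasureTheory.Measure.pi (fun _ : E => P)).real A *
              (1 - (MeasureTheory.Measure.pi (fun _ : E => P)).real A)) *
              (Real.log (Fintype.card E) / Fintype.card E)
            ≤ influence P A e) := by
  refine ⟨1 / 8, 1 / 16, by norm_num, by norm_num, fun Ω _ P _ E _ _ A hA hpos hlt => ?_⟩
  obtain ⟨e, he⟩ := exists_influence_pos P hA hpos hlt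
  have : Nonempty E := ⟨e⟩
  obtain ⟨e_max, he_max⟩ := Finite.exists_max (influence P A)
  set m := influence P A e_max
  set v := (MeasureTheory.Measure.pi fun _ : E => P).real A *
    (1 - (MeasureTheory.Measure.pi fun _ : E => P).real A)
  have hm : 0 < m := he.trans_le (he_max e)
  have hv : 0 < v := mul_pos hpos (sub_pos.2 hlt)
  have hv1 : v ≤ 1 := mul_le_one₀ hlt.le (sub_pos.2 hlt).le (sub_le_self 1 hpos.le)
  have hn : 1 ≤ (Fintype.card E : ℝ) := Nat.one_le_cast.2 Fintype.card_pos
  have bound : v * Real.log (1 / m) ≤ 8 * ∑ e, influence P A e :=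
    measureReal_mul_log_le_sum_influence P hA hm he_max
  refine ⟨⟨m, ⟨⟨e_max, rfl⟩, Set.forall_mem_range.2 he_max⟩, hm, ?_⟩, e_max, ?_⟩
  · have log_le : Real.log (1 / (2 * m)) ≤ Real.log (1 / m) :=
      Real.log_le_log (by positivity) (by gcongr; linarith)
    linarith [mul_le_mul_of_nonneg_left log_le hv.le]
  · have sum_le : ∑ e, influence P A e ≤ Fintype.card E * m :=
      (Finset.sum_le_card_nsmul _ _ m fun e _ => he_max e).trans_eq (nsmul_eq_mul _ _)
    have := mul_log_le_of_mul_log_inv_le hv.le hv1 hn hm (bound.trans (by gcongr))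
    rw [← mul_div_assoc, div_le_iff₀ (by positivity)]
    linarith
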